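/- Let $G$ be a group. Write $x^y = y^{-1}xy$ and $[x,y] = x^{-1}y^{-1}xy$, and let $H'$ denote the derived (commutator) subgroup of a group $H$. Let $G^{\varphi} = \{g^{\varphi} \mid g\in G\}$ be an isomorphic copy of $G$ via $\varphi\colon g\mapsto g^{\varphi}$, and let $$\nu(G) = \langle\, G\cup G^{\varphi} \mid [g_1,g_2^{\varphi}]^{g_3} = [g_1^{g_3},(g_2^{g_3})^{\varphi}] = [g_1,g_2^{\varphi}]^{g_3^{\varphi}} \text{ for all } g_1,g_2,g_3\in G \,\rangle ,$$ that is, the quotient of the free product $G * G^{\varphi}$ by the normal closure of these relations. For $n\ge 0$ put $[x,{}_0y]=x$ and $[x,{}_{n+1}y]=[[x,{}_ny],y]$. A group $H$ is called $n$-Engel if $[x,{}_ny]=1$ for all $x,y\in H$, and locally nilpotent if every finitely generated subgroup of $H$ is nilpotent. Then: (a) If $G'$ is nilpotent of class $c$, then $\nu(G)'$ is nilpotent of class at most $c+1$. (b) If $G'$ is $n$-Engel for some $n\ge 1$, then $\nu(G)'$ is $(n+1)$-Engel. (c) If $G'$ is locally nilpotent, then $\nu(G)'$ is locally nilpotent.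 -/

import Mathlib

/-- The conjugate `x ^ y = y⁻¹ x y`. -/
def rconj {H : Type*} [Group H] (x y : H) : H := y⁻¹ * x * y

/-- The commutator `[x, y] = x⁻¹ x ^ y = x⁻¹ y⁻¹ x y`. -/
def rcomm {H : Type*} [Group H] (x y : H) : H := x⁻¹ * rconj x y

/-- The iterated (Engel) commutator `[x, y, …, y]` with `n` entries `y`:
`[x, _0 y] = x` and `[x, _(n+1) y] = [[x, _n y], y]`. -/
def engelComm {H : Type*} [Group H] (x y : H) : ℕ → H
  | 0 => x
  | n + 1 => rcomm (engelComm x y n) y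

/-- A group is `n`-Engel if `[x, _n y] = 1` for all `x`, `y`. -/
def IsEngelGroup (n : ℕ) (H : Type*) [Group H] : Prop :=
  ∀ x y : H, engelComm x y n = 1

/-- A group is locally nilpotent if all its finitely generated subgroups are nilpotent. -/
def IsLocallyNilpotentGroup (H : Type*) [Group H] : Prop :=
  ∀ K : Subgroup H, K.FG → Group.IsNilpotent K

open Monoid.Coprod in
/-- The relators of `ν(G)` in the free product of `G` (the factor `inl`) and its isomorphic copy
`G^φ` (the factor `inr`, with `g^φ = inr g`).  They express
`[g₁, g₂^φ] ^ g₃ = [g₁ ^ g₃, (g₂ ^ g₃)^φ]` and `[g₁ ^ g₃, (g₂ ^ g₃)^φ] = [g₁, g₂^φ] ^ (g₃^φ)`;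
a relation `a = b` is given by the relator `a * b⁻¹`. -/
def nuRelators (G : Type*) [Group G] : Set (Monoid.Coprod G G) :=
  {r | ∃ g₁ g₂ g₃ : G,
    r = rconj (rcomm (inl g₁) (inr g₂)) (inl g₃) *
        (rcomm (inl (rconj g₁ g₃)) (inr (rconj g₂ g₃)))⁻¹ ∨
    r = rcomm (inl (rconj g₁ g₃)) (inr (rconj g₂ g₃)) *
        (rconj (rcomm (inl g₁) (inr g₂)) (inr g₃))⁻¹}

/-- The group `ν(G) = ⟨G ∪ G^φ | [g₁, g₂^φ] ^ g₃ = [g₁ ^ g₃, (g₂ ^ g₃)^φ] = [g₁, g₂^φ] ^ (g₃^φ)⟩`.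
-/
abbrev NuGroup (G : Type*) [Group G] : Type _ :=
  Monoid.Coprod G G ⧸ Subgroup.normalClosure (nuRelators G)

/-!
Write `Υ` for the subgroup of `ν(G)` generated by the commutators `[g, h^φ]`, and let
`ρ : ν(G) → G` be the folding map, which sends both `g` and `g^φ` to `g`.

The point is that the homomorphism `ν(G) → G × G × G` which sends `g` to `(g, 1, g)` and `g^φ` to
`(1, g, g)` has central kernel.  Indeed, the kernel of its first two components is `Υ`, since in
`ν(G) / Υ` the images of `G` and `G^φ` commute (`mem_nuUpsilon_of_fst_snd`).  The defining
relations say that `g` and `g^φ` act in the same way on `Υ`, so `[a, b^φ]` acts on `Υ` as `[a, b]`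
does, and a short computation gives `[t, g^φ] = [ρ t, g^φ]` for `t ∈ Υ` (`rcomm_nuRight_of_mem`).
Hence an element `t ∈ Υ` with `ρ t = 1` commutes with `G^φ`, and then also with `G`
(`mem_center_nuGroup`).

Restricting to derived subgroups, `ν(G)'` maps to `G' × G' × G'` with central kernel.  Each of the
three properties passes from `G'` to the cube of `G'`, and then to a central extension of a
subgroup of the cube, at the cost of one step in the nilpotency class or the Engel length.
-/

/-! ### Conjugates, commutators and central extensions -/

section General

variable {H K : Type*} [Group H] [Group K]

theorem rconj_mul_left (x y z : H) : rconj (x * y) z = rconj x z * rconj y z := by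
  simp only [rconj]; group

theorem rconj_inv_left (x z : H) : rconj x⁻¹ z = (rconj x z)⁻¹ := by
  simp only [rconj]; group

theorem rconj_mul_right (x y z : H) : rconj x (y * z) = rconj (rconj x y) z := by
  simp only [rconj]; group

theorem rcomm_mul_left (x y z : H) :
    rcomm (x * y) z = rconj (rcomm x z) y * rcomm y z := by
  simp only [rconj, rcomm]; group

theorem rcomm_inv_left (x z : H) : rcomm x⁻¹ z = (rconj (rcomm x z) x⁻¹)⁻¹ := by
  simp only [rconj, rcomm]; group

theorem rconj_rcomm (x y z : H) :
    rconj (rcomm x y) z = rcomm (rconj x z) (rconj y z) := by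
  simp only [rconj, rcomm]; group

theorem map_rconj (f : H →* K) (x y : H) : f (rconj x y) = rconj (f x) (f y) := by
  simp [rconj]

theorem map_rcomm (f : H →* K) (x y : H) : f (rcomm x y) = rcomm (f x) (f y) := by
  simp [rcomm, map_rconj]

theorem rcomm_eq_one_iff {x y : H} : rcomm x y = 1 ↔ x * y = y * x := by
  rw [rcomm, rconj, inv_mul_eq_one, eq_comm, mul_assoc, inv_mul_eq_iff_eq_mul]

theorem fg_map (f : H →* K) {S : Subgroup H} (hS : S.FG) : (S.map f).FG :=
  (Subgroup.fg_iff_submonoid_fg _).2 (((Subgroup.fg_iff_submonoid_fg _).1 hS).map f)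

theorem map_engelComm (f : H →* K) (x y : H) (n : ℕ) :
    f (engelComm x y n) = engelComm (f x) (f y) n := by
  induction n with
  | zero => rfl
  | succ n ih => simp only [engelComm, map_rcomm, ih]

theorem IsEngelGroup.prod {n : ℕ} (hH : IsEngelGroup n H) (hK : IsEngelGroup n K) :
    IsEngelGroup n (H × K) := fun x y => by
  refine Prod.ext ?_ ?_
  · exact (map_engelComm (MonoidHom.fst H K) x y n).trans (hH _ _)
  · exact (map_engelComm (MonoidHom.snd H K) x y n).trans (hK _ _)

theorem IsEngelGroup.of_ker_le_center {n : ℕ} (hK : IsEngelGroup n K) (f : H →* K)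
    (hf : f.ker ≤ Subgroup.center H) : IsEngelGroup (n + 1) H := fun x y => by
  have h : engelComm x y n ∈ Subgroup.center H :=
    hf ((map_engelComm f x y n).trans (hK _ _))
  exact rcomm_eq_one_iff.2 (Subgroup.mem_center_iff.1 h y).symm

theorem IsLocallyNilpotentGroup.prod (hH : IsLocallyNilpotentGroup H)
    (hK : IsLocallyNilpotentGroup K) : IsLocallyNilpotentGroup (H × K) := fun S hS => by
  have h₁ := hH (S.map (MonoidHom.fst H K)) (fg_map _ hS)
  have h₂ := hK (S.map (MonoidHom.snd H K)) (fg_map _ hS)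
  let g := ((MonoidHom.fst H K).subgroupMap S).prod ((MonoidHom.snd H K).subgroupMap S)
  refine Subgroup.isNilpotent_of_ker_le_center g fun x hx => ?_
  have hx1 : x = 1 := by
    have h := Prod.ext_iff.1 (MonoidHom.mem_ker.1 hx)
    exact Subtype.ext (Prod.ext (congrArg Subtype.val h.1) (congrArg Subtype.val h.2))
  exact hx1 ▸ one_mem _

theorem IsLocallyNilpotentGroup.of_ker_le_center (hK : IsLocallyNilpotentGroup K) (f : H →* K)
    (hf : f.ker ≤ Subgroup.center H) : IsLocallyNilpotentGroup H := fun S hS => by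
  have := hK (S.map f) (fg_map f hS)
  refine Subgroup.isNilpotent_of_ker_le_center (f.subgroupMap S) fun x hx => ?_
  have h : (x : H) ∈ Subgroup.center H := hf (congrArg Subtype.val (MonoidHom.mem_ker.1 hx))
  exact Subgroup.mem_center_iff.2 fun y => Subtype.ext (Subgroup.mem_center_iff.1 h y)

/-- The homomorphism `H' → K'` induced by `f : H → K`. -/
def commutatorMap (f : H →* K) : commutator H →* commutator K :=
  (f.comp (commutator H).subtype).codRestrict (commutator K) fun x => by
    have h : (commutator H).map f ≤ commutator K := by
      rw [commutator_def, Subgroup.map_commutator]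
      exact Subgroup.commutator_mono le_top le_top
    exact h (Subgroup.mem_map_of_mem f x.2)

theorem commutatorMap_eq_one {f : H →* K} {x : commutator H} (h : commutatorMap f x = 1) :
    f x = 1 :=
  congrArg Subtype.val h

end General

/-! ### The group `ν(G)` -/

section Nu

variable {G : Type*} [Group G]

/-- The canonical homomorphism `g ↦ g` from `G` to `ν(G)`. -/
def nuLeft : G →* NuGroup G := (QuotientGroup.mk' _).comp Monoid.Coprod.inl

/-- The canonical homomorphism `g ↦ g^φ` from `G` to `ν(G)`. -/
def nuRight : G →* NuGroup G := (QuotientGroup.mk' _).comp Monoid.Coprod.inr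

theorem rconj_rcomm_nuLeft (a b c : G) :
    rconj (rcomm (nuLeft a) (nuRight b)) (nuLeft c) =
      rcomm (nuLeft (rconj a c)) (nuRight (rconj b c)) := by
  have h := (QuotientGroup.eq_one_iff _).2
    (Subgroup.subset_normalClosure (s := nuRelators G) ⟨a, b, c, Or.inl rfl⟩)
  rw [← QuotientGroup.mk'_apply, map_mul, map_inv, mul_inv_eq_one] at h
  simp only [map_rconj, map_rcomm] at h ⊢
  exact h

theorem rconj_rcomm_nuRight (a b c : G) :
    rconj (rcomm (nuLeft a) (nuRight b)) (nuRight c) =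
      rcomm (nuLeft (rconj a c)) (nuRight (rconj b c)) := by
  have h := (QuotientGroup.eq_one_iff _).2
    (Subgroup.subset_normalClosure (s := nuRelators G) ⟨a, b, c, Or.inr rfl⟩)
  rw [← QuotientGroup.mk'_apply, map_mul, map_inv, mul_inv_eq_one] at h
  simp only [map_rconj, map_rcomm] at h ⊢
  exact h.symm

theorem nuGroup_induction {P : NuGroup G → Prop} (left : ∀ g, P (nuLeft g))
    (right : ∀ g, P (nuRight g)) (mul : ∀ x y, P x → P y → P (x * y)) (x : NuGroup G) : P x := by
  obtain ⟨x, rfl⟩ := QuotientGroup.mk_surjective x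
  induction x using Monoid.Coprod.induction_on with
  | inl g => exact left g
  | inr g => exact right g
  | mul x y hx hy => exact mul _ _ hx hy

/-- The homomorphism `ν(G) → K` given by homomorphisms on `G` and on `G^φ` that respect the
defining relations. -/
def nuLift {K : Type*} [Group K] (f₁ f₂ : G →* K)
    (h₁ : ∀ a b c, rconj (rcomm (f₁ a) (f₂ b)) (f₁ c) =
      rcomm (f₁ (rconj a c)) (f₂ (rconj b c)))
    (h₂ : ∀ a b c, rconj (rcomm (f₁ a) (f₂ b)) (f₂ c) =
      rcomm (f₁ (rconj a c)) (f₂ (rconj b c))) : NuGroup G →* K :=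
  QuotientGroup.lift _ (Monoid.Coprod.lift f₁ f₂) <| by
    refine Subgroup.normalClosure_le_normal ?_
    rintro _ ⟨a, b, c, rfl | rfl⟩
    · simp only [SetLike.mem_coe, MonoidHom.mem_ker, map_mul, map_inv, mul_inv_eq_one, map_rconj,
        map_rcomm, Monoid.Coprod.lift_apply_inl, Monoid.Coprod.lift_apply_inr, h₁]
    · simp only [SetLike.mem_coe, MonoidHom.mem_ker, map_mul, map_inv, mul_inv_eq_one, map_rconj,
        map_rcomm, Monoid.Coprod.lift_apply_inl, Monoid.Coprod.lift_apply_inr, h₂]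

/-- The folding map `ρ : ν(G) → G`, with `g ↦ g` and `g^φ ↦ g`. -/
def nuFold : NuGroup G →* G :=
  nuLift (MonoidHom.id G) (MonoidHom.id G) (fun a b c => rconj_rcomm a b c)
    (fun a b c => rconj_rcomm a b c)

/-- The homomorphism `ν(G) → G` with `g ↦ g` and `g^φ ↦ 1`. -/
def nuFst : NuGroup G →* G :=
  nuLift (MonoidHom.id G) 1 (fun a b c => by simp [rcomm, rconj, mul_assoc])
    (fun a b c => by simp [rcomm, rconj, mul_assoc])

/-- The homomorphism `ν(G) → G` with `g ↦ 1` and `g^φ ↦ g`. -/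
def nuSnd : NuGroup G →* G :=
  nuLift 1 (MonoidHom.id G) (fun a b c => by simp [rcomm, rconj, mul_assoc])
    (fun a b c => by simp [rcomm, rconj, mul_assoc])

@[simp] theorem nuFold_left (g : G) : nuFold (nuLeft g) = g := rfl
@[simp] theorem nuFold_right (g : G) : nuFold (nuRight g) = g := rfl
@[simp] theorem nuFst_left (g : G) : nuFst (nuLeft g) = g := rfl
@[simp] theorem nuFst_right (g : G) : nuFst (nuRight g) = 1 := rfl
@[simp] theorem nuSnd_left (g : G) : nuSnd (nuLeft g) = 1 := rfl
@[simp] theorem nuSnd_right (g : G) : nuSnd (nuRight g) = g := rfl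

/-! ### The subgroup `Υ = [G, G^φ]` and its intersection with the kernel of the folding map -/

variable (G) in
/-- The subgroup `Υ = [G, G^φ]` of `ν(G)`, generated by the commutators `[a, b^φ]`. -/
def nuUpsilon : Subgroup (NuGroup G) :=
  Subgroup.closure {t | ∃ a b : G, t = rcomm (nuLeft a) (nuRight b)}

theorem rcomm_mem_nuUpsilon (a b : G) : rcomm (nuLeft a) (nuRight b) ∈ nuUpsilon G :=
  Subgroup.subset_closure ⟨a, b, rfl⟩

theorem rconj_nuLeft_mem {t : NuGroup G} (ht : t ∈ nuUpsilon G) (c : G) :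
    rconj t (nuLeft c) ∈ nuUpsilon G := by
  induction ht using Subgroup.closure_induction with
  | mem t ht =>
    obtain ⟨a, b, rfl⟩ := ht
    rw [rconj_rcomm_nuLeft]
    exact rcomm_mem_nuUpsilon _ _
  | one => simp [rconj]
  | mul x y _ _ hx hy => rw [rconj_mul_left]; exact mul_mem hx hy
  | inv x _ hx => rw [rconj_inv_left]; exact inv_mem hx

theorem rconj_nuRight_eq {t : NuGroup G} (ht : t ∈ nuUpsilon G) (c : G) :
    rconj t (nuRight c) = rconj t (nuLeft c) := by
  induction ht using Subgroup.closure_induction with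
  | mem t ht =>
    obtain ⟨a, b, rfl⟩ := ht
    rw [rconj_rcomm_nuLeft, rconj_rcomm_nuRight]
  | one => simp [rconj]
  | mul x y _ _ hx hy => rw [rconj_mul_left, rconj_mul_left, hx, hy]
  | inv x _ hx => rw [rconj_inv_left, rconj_inv_left, hx]

/-- The conjugation action of `ν(G)` on `Υ` factors through the folding map. -/
theorem rconj_eq_rconj_nuFold (w : NuGroup G) {t : NuGroup G} (ht : t ∈ nuUpsilon G) :
    rconj t w = rconj t (nuLeft (nuFold w)) := by
  induction w using nuGroup_induction generalizing t with
  | left g => rw [nuFold_left]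
  | right g => rw [nuFold_right, rconj_nuRight_eq ht]
  | mul x y hx hy =>
    rw [rconj_mul_right, hx ht, hy (rconj_nuLeft_mem ht _), ← rconj_mul_right, ← map_mul,
      ← map_mul]

instance nuUpsilon_normal : (nuUpsilon G).Normal where
  conj_mem t ht w := by
    have h := rconj_nuLeft_mem ht (nuFold w⁻¹)
    rw [← rconj_eq_rconj_nuFold _ ht] at h
    simpa [rconj] using h

/-- `[[a, b^φ], c^φ] = [[a, b], c^φ]`. -/
theorem rcomm_rcomm_nuRight (a b c : G) :
    rcomm (rcomm (nuLeft a) (nuRight b)) (nuRight c) =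
      rcomm (nuLeft (rcomm a b)) (nuRight c) := by
  -- Both `a ^ b` and `a ^ (b^φ)` have the commutator `[a, (b c b⁻¹)^φ] ^ (b^φ)` with `c^φ`.
  have h : rcomm (rconj (nuLeft a) (nuRight b)) (nuRight c) =
      rcomm (nuLeft (rconj a b)) (nuRight c) := by
    have hc : rconj (b * c * b⁻¹) b = c := by simp only [rconj]; group
    have h' := rconj_rcomm_nuRight a (b * c * b⁻¹) b
    rwa [rconj_rcomm, ← map_rconj nuRight, hc] at h'
  have hm := rcomm_mem_nuUpsilon (G := G) a⁻¹ c
  calc rcomm (rcomm (nuLeft a) (nuRight b)) (nuRight c)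
      = rconj (rcomm (nuLeft a⁻¹) (nuRight c)) (rconj (nuLeft a) (nuRight b)) *
          rcomm (rconj (nuLeft a) (nuRight b)) (nuRight c) := by
        rw [map_inv, ← rcomm_mul_left, ← rcomm]
    _ = rconj (rcomm (nuLeft a⁻¹) (nuRight c)) (nuLeft (rconj a b)) *
          rcomm (nuLeft (rconj a b)) (nuRight c) := by
        rw [h, rconj_eq_rconj_nuFold _ hm, map_rconj nuFold, nuFold_left, nuFold_right]
    _ = rcomm (nuLeft (rcomm a b)) (nuRight c) := by
        rw [← rcomm_mul_left, ← map_mul, ← rcomm]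

/-- `[t, g^φ] = [ρ t, g^φ]` for `t ∈ Υ`. -/
theorem rcomm_nuRight_of_mem {t : NuGroup G} (ht : t ∈ nuUpsilon G) (g : G) :
    rcomm t (nuRight g) = rcomm (nuLeft (nuFold t)) (nuRight g) := by
  induction ht using Subgroup.closure_induction with
  | mem t ht =>
    obtain ⟨a, b, rfl⟩ := ht
    rw [rcomm_rcomm_nuRight, map_rcomm nuFold, nuFold_left, nuFold_right]
  | one => simp
  | mul x y _ _ hx hy =>
    rw [rcomm_mul_left, hx, hy, rconj_eq_rconj_nuFold _ (rcomm_mem_nuUpsilon _ _),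
      ← rcomm_mul_left, ← map_mul, ← map_mul]
  | inv x _ hx =>
    rw [rcomm_inv_left, hx, rconj_eq_rconj_nuFold _ (rcomm_mem_nuUpsilon _ _), map_inv, map_inv,
      ← rcomm_inv_left]

theorem mem_center_nuGroup {z : NuGroup G} (hz : z ∈ nuUpsilon G) (h : nuFold z = 1) :
    z ∈ Subgroup.center (NuGroup G) := by
  have hr (g : G) : rconj z (nuRight g) = z := by
    have := rcomm_nuRight_of_mem hz g
    rw [h, map_one, rcomm_eq_one_iff.2 (Commute.one_left (nuRight g)).eq, rcomm,
      inv_mul_eq_one] at this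
    exact this.symm
  refine Subgroup.mem_center_iff.2 fun w => ?_
  -- `w` acts on `Υ` as `ρ w` does, hence also as `(ρ w)^φ`.
  have hw : rconj z w = z := by
    rw [rconj_eq_rconj_nuFold w hz, ← rconj_nuRight_eq hz, hr]
  exact (rcomm_eq_one_iff.1 (by rw [rcomm, hw, inv_mul_cancel])).symm

/-- The kernel of `ν(G) → G × G` is contained in `Υ`: the quotient map `ν(G) → ν(G) / Υ` factors
through `G × G`. -/
theorem mem_nuUpsilon_of_fst_snd {x : NuGroup G} (h₁ : nuFst x = 1) (h₂ : nuSnd x = 1) :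
    x ∈ nuUpsilon G := by
  let q := QuotientGroup.mk' (nuUpsilon G)
  have hc (a b : G) : Commute (q (nuLeft a)) (q (nuRight b)) := by
    refine rcomm_eq_one_iff.1 ?_
    rw [← map_rcomm]
    exact (QuotientGroup.eq_one_iff _).2 (rcomm_mem_nuUpsilon a b)
  have key (y : NuGroup G) : q y = q (nuLeft (nuFst y)) * q (nuRight (nuSnd y)) := by
    induction y using nuGroup_induction with
    | left g => simp
    | right g => simp
    | mul y z hy hz =>
      simp only [map_mul]
      rw [hy, hz]
      exact (hc _ _).symm.mul_mul_mul_comm _ _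
  rw [← QuotientGroup.eq_one_iff]
  exact (key x).trans (by simp [h₁, h₂])

variable (G) in
/-- The homomorphism `ν(G)' → G' × G' × G'` induced by `g ↦ (g, 1, g)` and `g^φ ↦ (1, g, g)`. -/
def nuDerivedMap :
    commutator (NuGroup G) →* commutator G × commutator G × commutator G :=
  (commutatorMap nuFst).prod ((commutatorMap nuSnd).prod (commutatorMap nuFold))

theorem nuDerivedMap_ker_le_center :
    (nuDerivedMap G).ker ≤ Subgroup.center (commutator (NuGroup G)) := fun x hx => by
  have h := Prod.ext_iff.1 (MonoidHom.mem_ker.1 hx)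
  have h' := Prod.ext_iff.1 h.2
  have hz := mem_center_nuGroup
    (mem_nuUpsilon_of_fst_snd (commutatorMap_eq_one h.1) (commutatorMap_eq_one h'.1))
    (commutatorMap_eq_one h'.2)
  exact Subgroup.mem_center_iff.2 fun y => Subtype.ext (Subgroup.mem_center_iff.1 hz y)

end Nu

theorem mainTheorem5 (G : Type*) [Group G] :
    (∀ c : ℕ, Group.IsNilpotent (commutator G) → Group.nilpotencyClass (commutator G) = c →
      Group.IsNilpotent (commutator (NuGroup G)) ∧
        Group.nilpotencyClass (commutator (NuGroup G)) ≤ c + 1) ∧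
    (∀ n : ℕ, 1 ≤ n → IsEngelGroup n (commutator G) →
      IsEngelGroup (n + 1) (commutator (NuGroup G))) ∧
    (IsLocallyNilpotentGroup (commutator G) →
      IsLocallyNilpotentGroup (commutator (NuGroup G))) := by
  refine ⟨fun c hG hc => ?_, fun n _ hG => ?_, fun hG => ?_⟩
  · refine ⟨Subgroup.isNilpotent_of_ker_le_center _ nuDerivedMap_ker_le_center, ?_⟩
    have h := Group.nilpotencyClass_le_of_ker_le_center _ (nuDerivedMap_ker_le_center (G := G))
    rwa [Group.nilpotencyClass_prod, Group.nilpotencyClass_prod, max_self, max_self, hc] at h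
  · exact (hG.prod (hG.prod hG)).of_ker_le_center _ nuDerivedMap_ker_le_center
  · exact (hG.prod (hG.prod hG)).of_ker_le_center _ nuDerivedMap_ker_le_center
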